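/- Let $q=p^h$ be a power of a prime $p$ with $q\equiv -1\pmod 4$, let $\ell=2k+1>1$ be odd, and let $K=\mathbb F_{q^{2\ell}}$. A presemifield on $K$ is a multiplication that distributes over $+$ on both sides and for which left and right multiplication by each nonzero element are bijective. Two presemifield multiplications $\bullet,\star$ on $K$ are isotopic if there are $\mathbb F_p$-linear permutations $M,N,L$ of $K$ with $M(x)\star N(y)=L(x\bullet y)$ for all $x,y\in K$, and strongly isotopic if this is possible with $M=N$. Two functions $F,F':K\to K$ are CCZ-equivalent if some $\mathbb F_p$-affine permutation of $K^2$ maps the graph of $F$ onto the graph of $F'$. A polynomial $f=\sum_{i,j=0}^{2\ell h-1}a_{ij}X^{p^i+p^j}\in K[X]$ is called a Dembowski–Ostrom (DO) polynomial; it is planar if $x\mapsto f(x+a)-f(x)-f(a)$ is bijective for each $a\in K^*$. Let $P(q,\ell)=(K,+,*)$ with $$x*y=\tfrac12\left(xy+x^{q^\ell}y^{q^\ell}\right)+\tfrac14\,G\!\left(xy^{q^2}+x^{q^2}y\right),$$ $$G(x)=\sum_{i=0}^{k}(-1)^i(x-x^{q^\ell})^{q^{2i}}+\sum_{j=0}^{k-1}(-1)^{k+j}(x-x^{q^\ell})^{q^{2j+1}}.$$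 For a nonsquare $\bar\beta$ of $K$ lying in the subfield $\mathbb F_{q^2}$, and $\omega\in K\setminus\mathbb F_{q^\ell}$ with $\omega^{q^\ell}=-\omega$, let $\overline B(q,\ell,2,\bar\beta)=(K,+,\star)$ with $$x\star y=xy^{q^\ell}+x^{q^\ell}y+\left[\bar\beta\,(xy^{q^2}+x^{q^2}y)+\bar\beta^{q^\ell}(xy^{q^2}+x^{q^2}y)^{q^\ell}\right]\omega .$$ **Theorem.** Such $\bar\beta$ and $\omega$ exist, and for every such choice $P(q,\ell)$ and $\overline B(q,\ell,2,\bar\beta)$ are commutative presemifields that are not strongly isotopic. They are, however, isotopic, and there are planar DO polynomials $f,g\in K[X]$ with $x*y=f(x+y)-f(x)-f(y)$ and $x\star y=g(x+y)-g(x)-g(y)$ for all $x,y\in K$ such that the functions $f,g:K\to K$ are not CCZ-equivalent. -/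

import Mathlib

open Polynomial

/-- `m` is the multiplication of a presemifield on the additive group `A`: it is biadditive, and
left and right multiplications by nonzero elements are bijective (all the axioms of a skewfield,
except associativity and the existence of an identity). -/
structure IsPresemifield {A : Type*} [AddCommGroup A] (m : A → A → A) : Prop where
  nontrivial : Nontrivial A
  add_left : ∀ x y z, m (x + y) z = m x z + m y z
  add_right : ∀ x y z, m x (y + z) = m x y + m x z
  bijective_left : ∀ a, a ≠ 0 → Function.Bijective fun x => m a x
  bijective_right : ∀ a, a ≠ 0 → Function.Bijective fun x => m x a

/-- A presemifield whose multiplication is commutative. -/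
structure IsCommPresemifield {A : Type*} [AddCommGroup A] (m : A → A → A) : Prop
    extends IsPresemifield m where
  comm : ∀ x y, m x y = m y x

/-- Isotopic multiplications: `M(x) ⋆ N(y) = L(x • y)` for additive bijections `M`, `N`, `L`
(on elementary abelian `p`-groups these are the same as `𝔽_p`-linear permutations). -/
def IsIsotopic {A B : Type*} [AddCommGroup A] [AddCommGroup B]
    (m₁ : A → A → A) (m₂ : B → B → B) : Prop :=
  ∃ M N L : A ≃+ B, ∀ x y, m₂ (M x) (N y) = L (m₁ x y)

/-- Strongly isotopic multiplications: there is an isotopism `(M, N, L)` with `M = N`. -/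
def IsStronglyIsotopic {A B : Type*} [AddCommGroup A] [AddCommGroup B]
    (m₁ : A → A → A) (m₂ : B → B → B) : Prop :=
  ∃ M L : A ≃+ B, ∀ x y, m₂ (M x) (M y) = L (m₁ x y)

/-- A Dembowski–Ostrom polynomial over a field with `p ^ n` elements:
`∑_{i,j=0}^{n-1} a_{ij} X ^ (p ^ i + p ^ j)`. -/
def IsDembowskiOstrom {K : Type*} [Field K] (p n : ℕ) (f : K[X]) : Prop :=
  ∃ a : ℕ → ℕ → K,
    f = ∑ i ∈ Finset.range n, ∑ j ∈ Finset.range n, C (a i j) * X ^ (p ^ i + p ^ j)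

/-- The product `x ⋆ y = f(x + y) - f(x) - f(y)` attached to a polynomial `f`. -/
noncomputable def polarMul {K : Type*} [Field K] (f : K[X]) (x y : K) : K :=
  f.eval (x + y) - f.eval x - f.eval y

/-- A planar (perfect nonlinear) polynomial: `x ↦ f(x + a) - f(x) - f(a)` is bijective for each
nonzero `a`. -/
def IsPlanar {K : Type*} [Field K] (f : K[X]) : Prop :=
  ∀ a : K, a ≠ 0 → Function.Bijective fun x => f.eval (x + a) - f.eval x - f.eval a

/-- Carlet–Charpin–Zinoviev equivalence of functions `F, F' : K → K`: some affine permutation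
`v ↦ T v + c` of `K × K` (over the prime field, so `T` is an additive bijection) maps the graph of
`F` onto the graph of `F'`. -/
def CCZEquivalent {K : Type*} [Field K] (F F' : K → K) : Prop :=
  ∃ (T : (K × K) ≃+ (K × K)) (c : K × K),
    (fun v => T v + c) '' {v : K × K | v.2 = F v.1} = {v : K × K | v.2 = F' v.1}

/-- The map `G(x) = ∑_{i=0}^{k} (-1)^i (x - x^{q^ℓ})^{q^{2i}}
  + ∑_{j=0}^{k-1} (-1)^{k+j} (x - x^{q^ℓ})^{q^{2j+1}}`, with `ℓ = 2k + 1`. -/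
def lmptbMap {K : Type*} [Field K] (q ℓ : ℕ) (x : K) : K :=
  let k := (ℓ - 1) / 2
  (∑ i ∈ Finset.range (k + 1), (-1) ^ i * (x - x ^ q ^ ℓ) ^ q ^ (2 * i)) +
    ∑ j ∈ Finset.range k, (-1) ^ (k + j) * (x - x ^ q ^ ℓ) ^ q ^ (2 * j + 1)

/-- The multiplication of `P(q, ℓ)`. -/
def lmptbMul {K : Type*} [Field K] (q ℓ : ℕ) (x y : K) : K :=
  1 / 2 * (x * y + x ^ q ^ ℓ * y ^ q ^ ℓ) +
    1 / 4 * lmptbMap q ℓ (x * y ^ q ^ 2 + x ^ q ^ 2 * y)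

/-- The multiplication of `B̄(q, ℓ, d, β)`, formed with the element `ω`. -/
def bhbMul {K : Type*} [Field K] (q ℓ d : ℕ) (β ω x y : K) : K :=
  x * y ^ q ^ ℓ + x ^ q ^ ℓ * y +
    (β * (x * y ^ q ^ d + x ^ q ^ d * y) +
      β ^ q ^ ℓ * (x * y ^ q ^ d + x ^ q ^ d * y) ^ q ^ ℓ) * ω

/-- Admissible parameters in the field `K` with `q ^ (2ℓ)` elements: `β` lies in the subfield
`𝔽_{q²}` and is a nonsquare of `K`, and `ω ∉ 𝔽_{q^ℓ}` satisfies `ω^{q^ℓ} = -ω`. -/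
structure IsAdmissible {K : Type*} [Field K] (q ℓ : ℕ) (β ω : K) : Prop where
  mem_subfield : β ^ q ^ 2 = β
  nonsquare : ¬ IsSquare β
  notMem_subfield : ω ^ q ^ ℓ ≠ ω
  conj : ω ^ q ^ ℓ = -ω

/-! Write `σ = φ ^ ℓ` (an involution) and `τ = φ ^ 2`, with `φ` the `q`-Frobenius. Since `G` inverts
`1 + τ` up to a scalar on the `(-1)`-eigenspace of `σ`, the product `x * y` carries the same
information as the pair `xy + σxσy`, `z - σz` with `z = xτy + τxy`. Likewise `x ⋆ y` splits into the
`σ`-traces of `xσy` and of `βz`.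

Isotopy: with `a = β ^ ((q - 1) / 2)` one has `βa² = σβ` and `aσ(a) = -1`, and `M x = ax + σx`, `N y
= y - aσy` carry one pair to the other (`lmptbMul_isIsotopic_bhbMul`).

No strong isotopy: if `M = N`, the trace part of `⋆` gives an identity whose coefficients, in the
expansion over Galois automorphisms, force either `M = 0` or a `σ`-fixed square root of `-1`
(`eq_zero_of_trace_mul_conj_eq`). The latter is impossible because `q ^ ℓ ≡ 3 mod 4`.

CCZ: the planar polynomials represent `m x x / 2`, and for these CCZ-equivalence implies strong
isotopy (`CCZEquivalent.isStronglyIsotopic`). -/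

section Characters

/-! ### Linear and bilinear maps as combinations of Galois automorphisms -/

variable {F K : Type*} [Field F] [Field K] [Algebra F K] [FiniteDimensional F K]

omit [FiniteDimensional F K] in
theorem gal_linearIndependent :
    LinearIndependent K (fun g : K ≃ₐ[F] K => (g : K →ₐ[F] K).toLinearMap) :=
  (linearIndependent_toLinearMap F K K).comp (fun g : K ≃ₐ[F] K => (g : K →ₐ[F] K))
    fun _ _ h => AlgEquiv.ext fun x => DFunLike.congr_fun h x

theorem gal_coeff_unique {c d : (K ≃ₐ[F] K) → K}
    (h : ∀ x, ∑ g, c g * g x = ∑ g, d g * g x) : c = d := by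
  have h0 := Fintype.linearIndependent_iff.1 (gal_linearIndependent (F := F) (K := K))
    (fun g => c g - d g) (by
      ext x
      simp [sub_mul, Finset.sum_sub_distrib, h x])
  funext g
  exact sub_eq_zero.1 (h0 g)

theorem gal_coeff_unique₂ {A B : (K ≃ₐ[F] K) → (K ≃ₐ[F] K) → K}
    (h : ∀ x y, ∑ g, ∑ g', A g g' * g x * g' y = ∑ g, ∑ g', B g g' * g x * g' y) : A = B := by
  have key : ∀ y, (fun g => ∑ g', A g g' * g' y) = fun g => ∑ g', B g g' * g' y := by
    intro y
    refine gal_coeff_unique fun x => ?_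
    simpa [Finset.sum_mul, mul_right_comm] using h x y
  funext g
  exact gal_coeff_unique fun y => congrFun (key y) g

/-- The automorphisms are independent over `K`, and in the Galois case their number is the
`K`-dimension of the space of `F`-linear maps, so they form a basis. -/
theorem exists_gal_coeff [IsGalois F K] (f : K →ₗ[F] K) :
    ∃ c : (K ≃ₐ[F] K) → K, ∀ x, f x = ∑ g, c g * g x := by
  have hcard : Fintype.card (K ≃ₐ[F] K) = Module.finrank K (K →ₗ[F] K) := by
    rw [Module.finrank_linearMap_self, ← IsGalois.card_aut_eq_finrank, Nat.card_eq_fintype_card]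
  let b := basisOfLinearIndependentOfCardEqFinrank
    (gal_linearIndependent (F := F) (K := K)) hcard
  refine ⟨fun g => b.repr f g, fun x => ?_⟩
  conv_lhs => rw [← b.sum_repr f]
  simp [b]

theorem exists_gal_coeff₂ [IsGalois F K] (m : K → K → K)
    (hl : ∀ y, IsLinearMap F fun x => m x y) (hr : ∀ x, IsLinearMap F (m x)) :
    ∃ A : (K ≃ₐ[F] K) → (K ≃ₐ[F] K) → K, ∀ x y, m x y = ∑ g, ∑ g', A g g' * g x * g' y := by
  choose c hc using fun x => exists_gal_coeff ((hr x).mk' (m x))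
  simp only [IsLinearMap.mk'_apply] at hc
  -- Uniqueness of the coefficients makes them `F`-linear in `x`, so each can be expanded in turn.
  have hadd : ∀ x x', c (x + x') = c x + c x' := fun x x' => gal_coeff_unique fun y => by
    simp only [Pi.add_apply, add_mul, Finset.sum_add_distrib, ← hc]
    exact (hl y).map_add x x'
  have hsmul : ∀ (a : F) x, c (a • x) = a • c x := fun a x => gal_coeff_unique fun y => by
    simp only [Pi.smul_apply, smul_mul_assoc, ← Finset.smul_sum, ← hc]
    exact (hl y).map_smul a x
  choose A hA using fun g' => exists_gal_coeff (F := F) (K := K)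
    { toFun := fun x => c x g'
      map_add' := fun x x' => congrFun (hadd x x') g'
      map_smul' := fun a x => congrFun (hsmul a x) g' }
  simp only [LinearMap.coe_mk, AddHom.coe_mk] at hA
  refine ⟨fun g g' => A g' g, fun x y => ?_⟩
  rw [hc, Finset.sum_comm]
  exact Finset.sum_congr rfl fun g' _ => by rw [hA, Finset.sum_mul]

end Characters

/-! ### Coefficient comparison excluding strong isotopy -/

section Rigidity

variable {F K : Type*} [Field F] [Field K] [Algebra F K] [FiniteDimensional F K] [IsGalois F K]

/-- A linear map `M` for which the trace of `M x · σ (M y)` down to the fixed field of the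
involution `σ` is of the form `Λ (x y + σ x σ y) + Λ' (x τ y + τ x y)` vanishes, if `-1` is not
a square in that fixed field. -/
theorem eq_zero_of_trace_mul_conj_eq [IsMulCommutative (K ≃ₐ[F] K)]
    {σ τ : K ≃ₐ[F] K} (hσ : ∀ x, σ (σ x) = x) (hσ1 : σ ≠ 1) (hτ : τ ≠ 1)
    (hτσ : τ ≠ σ) (h2 : (2 : K) ≠ 0) (hs : ∀ s, σ s = s → s * s ≠ -1)
    (M Λ Λ' : K →ₗ[F] K)
    (h : ∀ x y, M x * σ (M y) + σ (M x) * M y =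
      Λ (x * y + σ x * σ y) + Λ' (x * τ y + τ x * y)) : M = 0 := by
  classical
  have hσσ : σ * σ = 1 := AlgEquiv.ext fun x => hσ x
  obtain ⟨m, hm⟩ := exists_gal_coeff M
  obtain ⟨c, hc⟩ := exists_gal_coeff Λ
  obtain ⟨d, hd⟩ := exists_gal_coeff Λ'
  have hm' : ∀ x, σ (M x) = ∑ g, σ (m (σ * g)) * g x := by
    intro x
    rw [hm, map_sum, ← Equiv.sum_comp (Equiv.mulLeft σ)]
    refine Finset.sum_congr rfl fun g _ => ?_
    simp [hσ]
  let δ : (K ≃ₐ[F] K) → (K ≃ₐ[F] K) → K := fun g g' => if g = g' then 1 else 0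
  have hc' : ∀ x y, Λ (x * y + σ x * σ y) =
      ∑ g, ∑ g', (δ g g' * (c g + c (g * σ))) * g x * g' y := by
    intro x y
    have h1 : ∑ g, c g * (g (σ x) * g (σ y)) = ∑ g, c (g * σ) * (g x * g y) := by
      rw [← Equiv.sum_comp (Equiv.mulRight σ)]
      refine Finset.sum_congr rfl fun g _ => ?_
      simp [hσ]
    rw [hc]
    simp only [map_add, map_mul, mul_add, Finset.sum_add_distrib, h1]
    simp [δ, Finset.sum_add_distrib, add_mul, mul_assoc, ite_mul]
  have hd' : ∀ x y, Λ' (x * τ y + τ x * y) =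
      ∑ g, ∑ g', (δ (g * τ) g' * d g + δ g (g' * τ) * d g') * g x * g' y := by
    intro x y
    rw [hd]
    simp only [add_mul, mul_add, map_add, map_mul, Finset.sum_add_distrib]
    congr 1
    · simp [δ, mul_assoc, ite_mul]
    · rw [Finset.sum_comm]
      simp [δ, mul_assoc, ite_mul]
  have key := gal_coeff_unique₂ (F := F) (K := K)
    (A := fun g g' => m g * σ (m (σ * g')) + σ (m (σ * g)) * m g')
    (B := fun g g' => δ g g' * (c g + c (g * σ)) +
      (δ (g * τ) g' * d g + δ g (g' * τ) * d g')) (by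
    intro x y
    have := h x y
    rw [hc', hd', hm' x, hm' y, hm x, hm y, Finset.sum_mul_sum, Finset.sum_mul_sum] at this
    simp only [← Finset.sum_add_distrib] at this
    convert this using 4 <;> ring)
  have hcomm : ∀ g, g * σ = σ * g := fun g => mul_comm' g σ
  -- The diagonal coefficients: `τ ≠ 1` removes `Λ'`, and the right side is symmetric under `g ↔ σ *
  -- g`.
  have hgg : ∀ g, m g * σ (m (σ * g)) + σ (m (σ * g)) * m g = c g + c (σ * g) := by
    intro g
    have := congrFun (congrFun key g) g
    simpa [δ, hτ, hcomm] using this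
  -- At `(g, σ * g)` the right side is zero, since `σ` is neither `1`, `τ` nor the inverse of `τ`.
  have hgs : ∀ g, m g * σ (m g) + σ (m (σ * g)) * m (σ * g) = 0 := by
    intro g
    have h1 := congrFun (congrFun key g) (σ * g)
    have e1 : g ≠ σ * g := fun h => hσ1 (by simpa using h)
    have e2 : g * τ ≠ σ * g := by rw [← hcomm]; simpa using hτσ
    have e3 : g ≠ σ * g * τ := fun h => hτσ (by
      rw [← hcomm, mul_assoc] at h
      have h' : σ * τ = 1 := by simpa using h
      rw [← one_mul τ, ← hσσ, mul_assoc, h', mul_one])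
    simpa [δ, ← mul_assoc, hσσ, e1, e2, e3] using h1
  -- If `m (σ * g) ≠ 0`, the quotient `s = m g / m (σ * g)` is `σ`-fixed by `hgg`, and then `hgs`
  -- says `s * s = -1`.
  have hm0 : ∀ g, m g = 0 := by
    intro g
    have h1 := hgg g
    have h3 := hgg (σ * g)
    rw [← mul_assoc, hσσ, one_mul, add_comm (c _)] at h3
    have h4 : m g * σ (m (σ * g)) = m (σ * g) * σ (m g) :=
      mul_left_cancel₀ h2 (by linear_combination h1 - h3)
    have h5 := hgs g
    by_cases hb : m (σ * g) = 0
    · simpa [hb] using h5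
    · have hb' : σ (m (σ * g)) ≠ 0 := by simpa using hb
      have hfix : σ (m g / m (σ * g)) = m g / m (σ * g) := by
        rw [map_div₀, div_eq_div_iff hb' hb]
        linear_combination -h4
      refine absurd ?_ (hs _ hfix)
      nth_rewrite 2 [← hfix]
      rw [map_div₀, div_mul_div_comm, div_eq_iff (mul_ne_zero hb hb')]
      linear_combination h5
  ext x
  simp [hm, hm0]

end Rigidity

/-! ### Planar functions and CCZ-equivalence -/

section QuadraticFunctions

/-- A commutative presemifield multiplication on a field of odd characteristic is the polar form
of a planar Dembowski–Ostrom polynomial, whose values are the halved squares. -/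
theorem IsCommPresemifield.exists_dembowskiOstrom {p n : ℕ} [Fact p.Prime] {K : Type*} [Field K]
    [Finite K] [Algebra (ZMod p) K] (hn : Module.finrank (ZMod p) K = n) (h2 : (2 : K) ≠ 0)
    {m : K → K → K} (hm : IsCommPresemifield m) :
    ∃ f : K[X], IsDembowskiOstrom p n f ∧ IsPlanar f ∧ polarMul f = m ∧
      ∀ x, f.eval x = m x x / 2 := by
  classical
  subst hn
  obtain ⟨A, hA⟩ := exists_gal_coeff₂ (F := ZMod p) m
    (fun y => ⟨fun x x' => hm.add_left x x' y, ZMod.map_smul (⟨⟨fun x => m x y, by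
      simpa using hm.add_left 0 0 y⟩, fun x x' => hm.add_left x x' y⟩ : K →+ K)⟩)
    (fun x => ⟨hm.add_right x, ZMod.map_smul (⟨⟨m x, by
      simpa using hm.add_right x 0 0⟩, hm.add_right x⟩ : K →+ K)⟩)
  let φ := FiniteField.frobeniusAlgEquivOfAlgebraic (ZMod p) K
  have hφ : ∀ (i : ℕ) (x : K), (φ ^ i) x = x ^ p ^ i := fun i x => by
    rw [AlgEquiv.coe_pow, FiniteField.coe_frobeniusAlgEquivOfAlgebraic_iterate, ZMod.card]
  have hsum : ∀ H : (K ≃ₐ[ZMod p] K) → K,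
      ∑ i ∈ Finset.range (Module.finrank (ZMod p) K), H (φ ^ i) = ∑ g, H g := fun H => by
    rw [Finset.sum_range, ← (Equiv.ofBijective _
      (FiniteField.bijective_frobeniusAlgEquivOfAlgebraic_pow (ZMod p) K)).sum_comp]
    rfl
  let f : K[X] := ∑ i ∈ Finset.range (Module.finrank (ZMod p) K),
    ∑ j ∈ Finset.range (Module.finrank (ZMod p) K),
      C (A (φ ^ i) (φ ^ j) / 2) * X ^ (p ^ i + p ^ j)
  have hf : ∀ x, f.eval x = m x x / 2 := by
    intro x
    rw [hA, Finset.sum_div, ← hsum]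
    simp only [f, eval_finsetSum, Finset.sum_div]
    refine Finset.sum_congr rfl fun i _ => ?_
    rw [← hsum]
    refine Finset.sum_congr rfl fun j _ => ?_
    simp only [eval_mul, eval_C, eval_pow, eval_X, hφ, pow_add]
    ring
  have hpolar : ∀ x y, f.eval (x + y) - f.eval x - f.eval y = m x y := by
    intro x y
    rw [hf, hf, hf, hm.add_left, hm.add_right, hm.add_right, hm.comm y x]
    field_simp
    ring
  refine ⟨f, ⟨_, rfl⟩, fun a ha => ?_, funext₂ hpolar, hf⟩
  simpa only [hpolar] using hm.bijective_right a ha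

/-- Coulter–Henderson, Kyureghyan–Pott, Budaghyan–Helleseth: for the planar functions attached to
commutative presemifields, CCZ-equivalence implies strong isotopy. -/
theorem CCZEquivalent.isStronglyIsotopic {K : Type*} [Field K] [Finite K] (h2 : (2 : K) ≠ 0)
    {m m' : K → K → K} (hm : IsCommPresemifield m) (hm' : IsCommPresemifield m')
    (h : CCZEquivalent (fun x => m x x / 2) fun x => m' x x / 2) : IsStronglyIsotopic m m' := by
  obtain ⟨T, ⟨a, b⟩, hT⟩ := h
  let A : K →+ K := (AddMonoidHom.fst K K).comp (T.toAddMonoidHom.comp (AddMonoidHom.inl K K))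
  let B : K →+ K := (AddMonoidHom.fst K K).comp (T.toAddMonoidHom.comp (AddMonoidHom.inr K K))
  let C : K →+ K := (AddMonoidHom.snd K K).comp (T.toAddMonoidHom.comp (AddMonoidHom.inl K K))
  let D : K →+ K := (AddMonoidHom.snd K K).comp (T.toAddMonoidHom.comp (AddMonoidHom.inr K K))
  have hTv : ∀ x y, T (x, y) = (A x + B y, C x + D y) := fun x y => by
    have : ((x, y) : K × K) = (x, 0) + (0, y) := by simp
    rw [this, map_add]
    rfl
  have hsq : ∀ x y, m (x + y) (x + y) / 2 = m x x / 2 + m y y / 2 + m x y := fun x y => by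
    rw [hm.add_left, hm.add_right, hm.add_right, hm.comm y x]
    field_simp
    ring
  have hsq' : ∀ x y, m' (x + y) (x + y) / 2 = m' x x / 2 + m' y y / 2 + m' x y := fun x y => by
    rw [hm'.add_left, hm'.add_right, hm'.add_right, hm'.comm y x]
    field_simp
    ring
  have hgraph : ∀ x, C x + D (m x x / 2) + b =
      m' (A x + B (m x x / 2) + a) (A x + B (m x x / 2) + a) / 2 := fun x => by
    have : T (x, m x x / 2) + (a, b) ∈ {v : K × K | v.2 = m' v.1 v.1 / 2} := by
      rw [← hT]
      exact ⟨_, rfl, rfl⟩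
    simpa [hTv] using this
  have hinj : ∀ x x', A x + B (m x x / 2) = A x' + B (m x' x' / 2) → x = x' := by
    intro x x' hxx
    have h1 := hgraph x
    have h3 := hgraph x'
    rw [← hxx, ← h1] at h3
    have : T (x, m x x / 2) = T (x', m x' x' / 2) := by
      rw [hTv, hTv, hxx, add_right_cancel h3]
    exact congrArg Prod.fst (T.injective this)
  -- If `y ≠ 0`, solve `m x y = -z - m y y / 2`. Moving from `x` to `x + y` then changes the
  -- quadratic value by `-z`, so `A x + B (m x x / 2)` takes the same value twice.
  have hAB : ∀ y z, A y = B z → y = 0 := by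
    intro y z hyz
    by_contra hy
    obtain ⟨x, hx⟩ := (hm.bijective_right y hy).2 (-z - m y y / 2)
    refine hy (add_eq_left.1 (hinj (x + y) x ?_))
    simp only at hx
    rw [hsq, hx]
    simp only [map_add, map_sub, map_neg, hyz]
    ring
  have hAinj : Function.Injective A := (injective_iff_map_eq_zero A).2 fun y hy =>
    hAB y 0 (by rw [hy, map_zero])
  have hB : ∀ z, B z = 0 := fun z => by
    obtain ⟨y, hy⟩ := (Finite.injective_iff_surjective.1 hAinj) (B z)
    rw [← hy, hAB y z hy, map_zero]
  have hDinj : Function.Injective D := (injective_iff_map_eq_zero D).2 fun y hy => by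
    have : T (0, y) = 0 := by simp [hTv, hB, hy]
    simpa using this
  refine ⟨AddEquiv.ofBijective A (Finite.injective_iff_bijective.1 hAinj),
    AddEquiv.ofBijective D (Finite.injective_iff_bijective.1 hDinj), fun x y => ?_⟩
  simp only [AddEquiv.ofBijective_apply]
  simp only [hB, add_zero] at hgraph
  have e0 := hgraph 0
  have ex := hgraph x
  have ey := hgraph y
  have exy := hgraph (x + y)
  have hm0 : m 0 0 = 0 := by simpa using hm.add_left 0 0 0
  rw [hsq, map_add, map_add, map_add, map_add, add_right_comm (A x), add_assoc (A x),
    hsq' (A x)] at exy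
  rw [hsq'] at ex ey
  rw [add_comm a, hsq' (A y) a, hm'.add_right] at exy
  simp only [map_zero, zero_add, hm0, zero_div] at e0
  -- The mixed second difference kills the additive map `C` and the constants, leaving the polar
  -- forms.
  linear_combination ex + ey - exy - e0

end QuadraticFunctions

/-! ### Presemifield criteria -/

section Presemifields

theorem IsPresemifield.of_noZeroDivisors {A : Type*} [AddCommGroup A] [Finite A] [Nontrivial A]
    {m : A → A → A} (hl : ∀ x y z, m (x + y) z = m x z + m y z)
    (hr : ∀ x y z, m x (y + z) = m x y + m x z) (h0 : ∀ x y, m x y = 0 → x = 0 ∨ y = 0) :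
    IsPresemifield m where
  nontrivial := inferInstance
  add_left := hl
  add_right := hr
  bijective_left a ha := Finite.injective_iff_bijective.1 <|
    (injective_iff_map_eq_zero (AddMonoidHom.mk' (m a) (hr a))).2 fun x hx =>
      (h0 a x hx).resolve_left ha
  bijective_right a ha := Finite.injective_iff_bijective.1 <|
    (injective_iff_map_eq_zero (AddMonoidHom.mk' (fun x => m x a) fun x y => hl x y a)).2
      fun x hx => (h0 x a hx).resolve_right ha

theorem IsIsotopic.isPresemifield {A B : Type*} [AddCommGroup A] [AddCommGroup B]
    {m : A → A → A} {m' : B → B → B} (h : IsIsotopic m m') (hm : IsPresemifield m) :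
    IsPresemifield m' := by
  obtain ⟨M, N, L, h⟩ := h
  have hm' : ∀ u v, m' u v = L (m (M.symm u) (N.symm v)) := fun u v => by simp [← h]
  have := hm.nontrivial
  refine ⟨M.symm.surjective.nontrivial, fun x y z => ?_, fun x y z => ?_, fun a ha => ?_,
    fun a ha => ?_⟩
  · simp [hm', hm.add_left]
  · simp [hm', hm.add_right]
  · simp only [hm']
    exact L.bijective.comp ((hm.bijective_left (M.symm a) (by simpa using ha)).comp
      N.symm.bijective)
  · simp only [hm']
    exact L.bijective.comp ((hm.bijective_right (N.symm a) (by simpa using ha)).comp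
      M.symm.bijective)

end Presemifields

/-! ### The two multiplications and their isotopism -/

section FrobeniusPowers

variable {F K : Type*} [Field F] [Field K] [Algebra F K] {q ℓ : ℕ} {φ : K ≃ₐ[F] K}

theorem frobenius_pow_apply (hφ : ∀ x, φ x = x ^ q) (i : ℕ) (x : K) : (φ ^ i) x = x ^ q ^ i := by
  induction i generalizing x with
  | zero => simp
  | succ n ih => rw [pow_succ, AlgEquiv.mul_apply, ih, hφ, ← pow_mul, pow_succ']

theorem aut_pow_apply_pow_apply (i j : ℕ) (x : K) :
    (φ ^ i) ((φ ^ j) x) = (φ ^ (i + j)) x := by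
  rw [pow_add, AlgEquiv.mul_apply]

theorem aut_pow_apply_comm (i j : ℕ) (x : K) :
    (φ ^ i) ((φ ^ j) x) = (φ ^ j) ((φ ^ i) x) := by
  rw [aut_pow_apply_pow_apply, aut_pow_apply_pow_apply, add_comm]

theorem lmptbMap_eq (hφ : ∀ x, φ x = x ^ q) (k : ℕ) (x : K) :
    lmptbMap q (2 * k + 1) x =
      (∑ i ∈ Finset.range (k + 1), (-1) ^ i * (φ ^ (2 * i)) (x - (φ ^ (2 * k + 1)) x)) +
      ∑ j ∈ Finset.range k, (-1) ^ (k + j) * (φ ^ (2 * j + 1)) (x - (φ ^ (2 * k + 1)) x) := by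
  simp only [lmptbMap, frobenius_pow_apply hφ]
  rw [show (2 * k + 1 - 1) / 2 = k by omega]

theorem lmptbMap_add (hφ : ∀ x, φ x = x ^ q) (hℓ : Odd ℓ) (x y : K) :
    lmptbMap q ℓ (x + y) = lmptbMap q ℓ x + lmptbMap q ℓ y := by
  obtain ⟨k, rfl⟩ := hℓ
  simp only [lmptbMap_eq hφ, map_add, map_sub, mul_add, mul_sub, Finset.sum_add_distrib,
    Finset.sum_sub_distrib]
  ring

theorem lmptbMap_conj (hφ : ∀ x, φ x = x ^ q) (hσ : ∀ x, (φ ^ ℓ) ((φ ^ ℓ) x) = x) (hℓ : Odd ℓ)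
    (x : K) : (φ ^ ℓ) (lmptbMap q ℓ x) = -lmptbMap q ℓ x := by
  obtain ⟨k, rfl⟩ := hℓ
  have h (n : ℕ) : (φ ^ (2 * k + 1)) ((φ ^ n) (x - (φ ^ (2 * k + 1)) x)) =
      -(φ ^ n) (x - (φ ^ (2 * k + 1)) x) := by
    rw [aut_pow_apply_comm, map_sub (φ ^ (2 * k + 1)), hσ, ← map_neg, neg_sub]
  simp only [lmptbMap_eq hφ, map_add, map_sum, map_mul, map_pow, map_neg, map_one, h, mul_neg,
    Finset.sum_neg_distrib, neg_add]

theorem alternating_sum_add_sq_apply (w : K) (n : ℕ) :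
    (∑ i ∈ Finset.range n, (-1) ^ i * (φ ^ (2 * i)) w) +
      (φ ^ 2) (∑ i ∈ Finset.range n, (-1) ^ i * (φ ^ (2 * i)) w) =
      w - (-1) ^ n * (φ ^ (2 * n)) w := by
  induction n with
  | zero => simp
  | succ n ih =>
    rw [Finset.sum_range_succ, map_add, map_mul, aut_pow_apply_pow_apply, map_pow, map_neg,
      map_one, show 2 + 2 * n = 2 * (n + 1) by ring, pow_succ (-1 : K)]
    linear_combination ih

/-- On the elements `w` with `w ^ q ^ ℓ = -w`, the map `lmptbMap` is, up to a scalar, the inverse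
of `w ↦ w + w ^ q ^ 2`. -/
theorem lmptbMap_add_sq_apply (hφ : ∀ x, φ x = x ^ q) (hσ : ∀ x, (φ ^ ℓ) ((φ ^ ℓ) x) = x)
    (hℓ : Odd ℓ) (x : K) :
    lmptbMap q ℓ x + (φ ^ 2) (lmptbMap q ℓ x) = 2 * (x - (φ ^ ℓ) x) := by
  obtain ⟨k, rfl⟩ := hℓ
  rw [lmptbMap_eq hφ]
  set w := x - (φ ^ (2 * k + 1)) x with hw
  have hσw : (φ ^ (2 * k + 1)) w = -w := by rw [hw, map_sub, hσ, neg_sub]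
  have h1 := alternating_sum_add_sq_apply (φ := φ) w (k + 1)
  have h2 := alternating_sum_add_sq_apply (φ := φ) (φ w) k
  have e1 : (φ ^ (2 * (k + 1))) w = -φ w := by
    rw [show 2 * (k + 1) = 1 + (2 * k + 1) by ring, pow_add, AlgEquiv.mul_apply, hσw, pow_one,
      map_neg]
  have e2 : (φ ^ (2 * k)) (φ w) = -w := by
    rw [← hσw, pow_succ, AlgEquiv.mul_apply]
  have e3 : ∑ j ∈ Finset.range k, (-1) ^ (k + j) * (φ ^ (2 * j + 1)) w =
      (-1) ^ k * ∑ i ∈ Finset.range k, (-1) ^ i * (φ ^ (2 * i)) (φ w) := by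
    rw [Finset.mul_sum]
    refine Finset.sum_congr rfl fun j _ => ?_
    rw [pow_add, mul_assoc, pow_succ φ, AlgEquiv.mul_apply]
  have hk : ((-1 : K) ^ k) * (-1) ^ k = 1 := by rw [← mul_pow]; simp
  rw [e1, pow_succ (-1 : K)] at h1
  rw [e2] at h2
  rw [e3, map_add, map_mul, map_pow, map_neg, map_one]
  linear_combination h1 + (-1) ^ k * h2 + w * hk

/-- If `φ ^ 2` negates `u`, then `φ ^ (2 * ℓ) = 1` multiplies it by `(-1) ^ ℓ = -1`. -/
theorem eq_zero_of_add_sq_apply_eq_zero (h2 : (2 : K) ≠ 0) (hσ : ∀ x, (φ ^ ℓ) ((φ ^ ℓ) x) = x)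
    (hℓ : Odd ℓ) {u : K} (hu : u + (φ ^ 2) u = 0) : u = 0 := by
  have h1 : (φ ^ 2) u = -u := by linear_combination hu
  have h3 (n : ℕ) : (φ ^ (2 * n)) u = (-1) ^ n * u := by
    induction n with
    | zero => simp
    | succ n ih =>
      rw [mul_add, mul_one, pow_add, AlgEquiv.mul_apply, h1, map_neg, ih]
      ring
  have h4 := hσ u
  rw [aut_pow_apply_pow_apply, ← two_mul, h3, hℓ.neg_one_pow] at h4
  have : 2 * u = 0 := by linear_combination -h4
  exact (mul_eq_zero.1 this).resolve_left h2

theorem lmptbMul_eq (hφ : ∀ x, φ x = x ^ q) (x y : K) :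
    lmptbMul q ℓ x y = 1 / 2 * (x * y + (φ ^ ℓ) x * (φ ^ ℓ) y) +
      1 / 4 * lmptbMap q ℓ (x * (φ ^ 2) y + (φ ^ 2) x * y) := by
  simp only [lmptbMul, frobenius_pow_apply hφ]

theorem bhbMul_eq (hφ : ∀ x, φ x = x ^ q) (β ω x y : K) :
    bhbMul q ℓ 2 β ω x y = x * (φ ^ ℓ) y + (φ ^ ℓ) x * y +
      (β * (x * (φ ^ 2) y + (φ ^ 2) x * y) +
        (φ ^ ℓ) (β * (x * (φ ^ 2) y + (φ ^ 2) x * y))) * ω := by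
  simp only [bhbMul, frobenius_pow_apply hφ, mul_pow]

theorem lmptbMul_comm (x y : K) : lmptbMul q ℓ x y = lmptbMul q ℓ y x := by
  simp only [lmptbMul]
  rw [add_comm (x * y ^ q ^ 2)]
  simp only [mul_comm]

theorem bhbMul_comm (β ω x y : K) : bhbMul q ℓ 2 β ω x y = bhbMul q ℓ 2 β ω y x := by
  simp only [bhbMul]
  rw [add_comm (x * y ^ q ^ 2), add_comm (x * y ^ q ^ ℓ)]
  simp only [mul_comm]

/-- The two summands of `x * y` lie in opposite eigenspaces of `σ`, so both vanish if the product
does. Writing `y = wσx`, the first gives `σw = -w`; the second then factors, one factor being `w +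
τw` and the other excluded by `hr`. -/
theorem lmptbMul_isCommPresemifield [Finite K] (hφ : ∀ x, φ x = x ^ q) (h2 : (2 : K) ≠ 0)
    (hσ : ∀ x, (φ ^ ℓ) ((φ ^ ℓ) x) = x) (hℓ : Odd ℓ)
    (hr : ∀ x, x ≠ 0 → (φ ^ ℓ) ((φ ^ 2) x / x) ≠ -((φ ^ 2) x / x)) :
    IsCommPresemifield (lmptbMul q ℓ : K → K → K) := by
  have hadd : ∀ x y z : K, lmptbMul q ℓ (x + y) z = lmptbMul q ℓ x z + lmptbMul q ℓ y z := by
    intro x y z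
    simp only [lmptbMul_eq hφ, map_add]
    rw [show (x + y) * (φ ^ 2) z + ((φ ^ 2) x + (φ ^ 2) y) * z =
      (x * (φ ^ 2) z + (φ ^ 2) x * z) + (y * (φ ^ 2) z + (φ ^ 2) y * z) by ring,
      lmptbMap_add hφ hℓ]
    ring
  refine ⟨IsPresemifield.of_noZeroDivisors hadd (fun x y z => ?_) fun x y hxy => ?_,
    lmptbMul_comm⟩
  · rw [lmptbMul_comm, hadd, lmptbMul_comm y, lmptbMul_comm z]
  · rw [lmptbMul_eq hφ] at hxy
    have hxy' := congrArg (φ ^ ℓ) hxy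
    simp only [map_add, map_mul, map_div₀, map_one, map_ofNat, hσ, lmptbMap_conj hφ hσ hℓ,
      map_zero] at hxy'
    set z := x * (φ ^ 2) y + (φ ^ 2) x * y with hz
    have h4 : (4 : K) ≠ 0 := by
      rw [show (4 : K) = 2 * 2 by norm_num]
      exact mul_ne_zero h2 h2
    have hS : x * y + (φ ^ ℓ) x * (φ ^ ℓ) y = 0 := by
      field_simp at hxy hxy'
      refine (mul_eq_zero.1 ?_).resolve_left (mul_ne_zero h2 h4)
      linear_combination hxy + hxy'
    have hG : lmptbMap q ℓ z = 0 := by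
      rw [hS, mul_zero, zero_add] at hxy
      simpa [h4] using hxy
    have hT := lmptbMap_add_sq_apply hφ hσ hℓ z
    rw [hG, map_zero, add_zero, eq_comm] at hT
    have hT' := (mul_eq_zero.1 hT).resolve_left h2
    by_contra! hne
    obtain ⟨hx, hy⟩ := hne
    have hσx : (φ ^ ℓ) x ≠ 0 := (map_ne_zero_iff _ (φ ^ ℓ).injective).2 hx
    obtain ⟨w, rfl⟩ : ∃ w, y = w * (φ ^ ℓ) x := ⟨y / (φ ^ ℓ) x, by field_simp⟩
    have hw : (φ ^ ℓ) w = -w := by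
      rw [map_mul, hσ] at hS
      refine mul_left_cancel₀ (mul_ne_zero hx hσx) ?_
      linear_combination hS
    have hprod : (w + (φ ^ 2) w) *
        (x * (φ ^ ℓ) ((φ ^ 2) x) + (φ ^ 2) x * (φ ^ ℓ) x) = 0 := by
      rw [hz] at hT'
      simp only [map_add, map_mul, hσ, aut_pow_apply_comm ℓ 2, hw, map_neg] at hT' ⊢
      linear_combination hT'
    rcases mul_eq_zero.1 hprod with h | h
    · have := eq_zero_of_add_sq_apply_eq_zero h2 hσ hℓ h
      simp [this] at hy
    · refine hr x hx ?_
      rw [map_div₀, ← neg_div, div_eq_div_iff hσx hx]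
      linear_combination h

theorem lmptbMul_isIsotopic_bhbMul [Finite K] (hφ : ∀ x, φ x = x ^ q) (h2 : (2 : K) ≠ 0)
    (hσ : ∀ x, (φ ^ ℓ) ((φ ^ ℓ) x) = x) (hℓ : Odd ℓ) {β ω a : K} (hω : (φ ^ ℓ) ω = -ω)
    (hω0 : ω ≠ 0) (hβ0 : β ≠ 0) (ha : (φ ^ 2) a = a) (haβ : β * a ^ 2 = (φ ^ ℓ) β)
    (haa : a * (φ ^ ℓ) a = -1) :
    IsIsotopic (lmptbMul q ℓ : K → K → K) (bhbMul q ℓ 2 β ω) := by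
  have h4 : (4 : K) ≠ 0 := by
    rw [show (4 : K) = 2 * 2 by norm_num]
    exact mul_ne_zero h2 h2
  have ha0 : a ≠ 0 := by
    rintro rfl
    simp at haa
  set b := (φ ^ ℓ) a with hb
  have hσb : (φ ^ ℓ) b = a := hσ a
  have hτb : (φ ^ 2) b = b := by rw [hb, aut_pow_apply_comm, ha]
  have hne : ∀ x : K, a * x + (φ ^ ℓ) x = 0 → x = 0 := fun x hx => by
    have h := congrArg (φ ^ ℓ) hx
    rw [map_add, map_mul, hσ, map_zero, ← hb] at h
    refine (mul_eq_zero.1 (?_ : 2 * x = 0)).resolve_left h2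
    linear_combination h - b * hx + x * haa
  -- The coefficient of `xτy` in the trace of `β(M x · τ(N y))`; it equals `2βa` because `aσ(a) =
  -- -1`.
  let V := β * a - (φ ^ ℓ) (β * a)
  have hσV : (φ ^ ℓ) V = -V := by simp only [V, map_sub, hσ, neg_sub]
  have hV0 : V ≠ 0 := by
    intro hV
    have h1 : β * a * 2 = 0 := by
      simp only [V, map_mul, ← haβ, ← hb] at hV
      linear_combination hV + β * a * haa
    simp [hβ0, ha0, h2] at h1
  let M : K →+ K := AddMonoidHom.mk' (fun x => a * x + (φ ^ ℓ) x) fun x y => by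
    simp only [map_add]; ring
  let N : K →+ K := AddMonoidHom.mk' (fun x => x - a * (φ ^ ℓ) x) fun x y => by
    simp only [map_add]; ring
  -- On the `σ`-antisymmetric part of `u`, applying `1 + φ ^ 2` undoes `G`.
  let L : K →+ K := AddMonoidHom.mk' (fun u => 2 * (u + (φ ^ ℓ) u) +
      ω * V * ((u - (φ ^ ℓ) u) + (φ ^ 2) (u - (φ ^ ℓ) u))) fun x y => by
    simp only [map_add, map_sub]; ring
  have hM : Function.Injective M := (injective_iff_map_eq_zero M).2 hne
  have hN : Function.Injective N := (injective_iff_map_eq_zero N).2 fun x hx => by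
    have hx' : x - a * (φ ^ ℓ) x = 0 := hx
    have h := congrArg (φ ^ ℓ) hx'
    rw [map_sub, map_mul, hσ, map_zero, ← hb] at h
    refine (mul_eq_zero.1 (?_ : 2 * x = 0)).resolve_left h2
    linear_combination hx' + a * h + x * haa
  have hL : Function.Injective L := (injective_iff_map_eq_zero L).2 fun u hu => by
    have hu' : 2 * (u + (φ ^ ℓ) u) +
      ω * V * ((u - (φ ^ ℓ) u) + (φ ^ 2) (u - (φ ^ ℓ) u)) = 0 := hu
    have h := congrArg (φ ^ ℓ) hu'
    simp only [map_add, map_sub, map_mul, map_ofNat, hσ, hω, hσV, aut_pow_apply_comm ℓ 2,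
      map_zero] at h
    have hs : u + (φ ^ ℓ) u = 0 := by
      refine (mul_eq_zero.1 ?_).resolve_left h4
      rw [map_sub] at hu'
      linear_combination hu' + h
    rw [hs, mul_zero, zero_add] at hu'
    have ht := eq_zero_of_add_sq_apply_eq_zero h2 hσ hℓ
      ((mul_eq_zero.1 hu').resolve_left (mul_ne_zero hω0 hV0))
    refine (mul_eq_zero.1 (?_ : 2 * u = 0)).resolve_left h2
    linear_combination hs + ht
  refine ⟨AddEquiv.ofBijective M (Finite.injective_iff_bijective.1 hM),
    AddEquiv.ofBijective N (Finite.injective_iff_bijective.1 hN),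
    AddEquiv.ofBijective L (Finite.injective_iff_bijective.1 hL), fun x y => ?_⟩
  simp only [AddEquiv.ofBijective_apply]
  change bhbMul q ℓ 2 β ω (a * x + (φ ^ ℓ) x) (y - a * (φ ^ ℓ) y) =
    2 * (lmptbMul q ℓ x y + (φ ^ ℓ) (lmptbMul q ℓ x y)) +
      ω * V * ((lmptbMul q ℓ x y - (φ ^ ℓ) (lmptbMul q ℓ x y)) +
        (φ ^ 2) (lmptbMul q ℓ x y - (φ ^ ℓ) (lmptbMul q ℓ x y)))
  have hmul := lmptbMul_eq (ℓ := ℓ) hφ x y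
  have hG := lmptbMap_add_sq_apply hφ hσ hℓ (x * (φ ^ 2) y + (φ ^ 2) x * y)
  set g := lmptbMap q ℓ (x * (φ ^ 2) y + (φ ^ 2) x * y) with hg
  have hmul' : (φ ^ ℓ) (lmptbMul q ℓ x y) =
      1 / 2 * (x * y + (φ ^ ℓ) x * (φ ^ ℓ) y) - 1 / 4 * g := by
    rw [hmul]
    simp only [map_add, map_mul, map_div₀, map_one, map_ofNat, hσ, hg, lmptbMap_conj hφ hσ hℓ]
    ring
  have hadd : lmptbMul q ℓ x y + (φ ^ ℓ) (lmptbMul q ℓ x y) =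
      x * y + (φ ^ ℓ) x * (φ ^ ℓ) y := by
    rw [hmul', hmul]
    field_simp
    ring
  have hsub : lmptbMul q ℓ x y - (φ ^ ℓ) (lmptbMul q ℓ x y) = g / 2 := by
    rw [hmul', hmul]
    field_simp
    ring
  have hT : g / 2 + (φ ^ 2) (g / 2) = (x * (φ ^ 2) y + (φ ^ 2) x * y) -
      (φ ^ ℓ) (x * (φ ^ 2) y + (φ ^ 2) x * y) := by
    rw [map_div₀, map_ofNat, ← add_div, hG]
    field_simp
  rw [hadd, hsub, hT, bhbMul_eq hφ]
  simp only [V, map_add, map_sub, map_mul, hσ, ha, ← hb, aut_pow_apply_comm ℓ 2]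
  set x' := (φ ^ ℓ) x
  set y' := (φ ^ ℓ) y
  linear_combination -(x * y + x' * y') * haa + ω * (-(x * (φ ^ 2) y' + (φ ^ 2) x * y') * haβ +
    (x' * (φ ^ 2) y + (φ ^ 2) x' * y) * (b ^ 2 * haβ + β * (1 - a * b) * haa))

end FrobeniusPowers

/-! ### Absence of a strong isotopism -/

section NotStronglyIsotopic

variable {p q ℓ : ℕ} {K : Type*} [Field K] [Algebra (ZMod p) K]

theorem not_isStronglyIsotopic_lmptbMul_bhbMul [Fact p.Prime] [Finite K]
    {φ : K ≃ₐ[ZMod p] K} (hφ : ∀ x, φ x = x ^ q)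
    (h2 : (2 : K) ≠ 0) (hσ : ∀ x, (φ ^ ℓ) ((φ ^ ℓ) x) = x) (hℓ : Odd ℓ)
    (hs : ∀ s, (φ ^ ℓ) s = s → s * s ≠ -1) (h1 : φ ^ ℓ ≠ 1) (hτ : φ ^ 2 ≠ 1)
    (hτσ : φ ^ 2 ≠ φ ^ ℓ) {β ω : K} (hω : (φ ^ ℓ) ω = -ω) :
    ¬ IsStronglyIsotopic (lmptbMul q ℓ : K → K → K) (bhbMul q ℓ 2 β ω) := by
  rintro ⟨M, L, h⟩
  -- Averaging with `σ` removes the `ω`-part of `⋆`, as `σω = -ω`. The maps `Λ` and `Λ'` are what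
  -- `L` becomes on the two summands of `x * y`.
  let Λ : K →+ K := AddMonoidHom.mk'
    (fun z => (L (1 / 2 * z) + (φ ^ ℓ) (L (1 / 2 * z))) / 2) fun x y => by
      simp only [mul_add, map_add]; ring
  let Λ' : K →+ K := AddMonoidHom.mk'
    (fun z => (L (1 / 4 * lmptbMap q ℓ z) + (φ ^ ℓ) (L (1 / 4 * lmptbMap q ℓ z))) / 2)
    fun x y => by simp only [lmptbMap_add hφ hℓ, mul_add, map_add]; ring
  have hM := eq_zero_of_trace_mul_conj_eq hσ h1 hτ hτσ h2 hs
    (M.toAddMonoidHom.toZModLinearMap p) (Λ.toZModLinearMap p) (Λ'.toZModLinearMap p)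
    (fun x y => by
      change M x * (φ ^ ℓ) (M y) + (φ ^ ℓ) (M x) * M y =
        (L (1 / 2 * (x * y + (φ ^ ℓ) x * (φ ^ ℓ) y)) +
          (φ ^ ℓ) (L (1 / 2 * (x * y + (φ ^ ℓ) x * (φ ^ ℓ) y)))) / 2 +
        (L (1 / 4 * lmptbMap q ℓ (x * (φ ^ 2) y + (φ ^ 2) x * y)) +
          (φ ^ ℓ) (L (1 / 4 * lmptbMap q ℓ (x * (φ ^ 2) y + (φ ^ 2) x * y)))) / 2
      have e := h x y
      have e' := congrArg (φ ^ ℓ) e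
      rw [bhbMul_eq hφ, lmptbMul_eq hφ, map_add] at e e'
      rw [map_add L, map_add (φ ^ ℓ) (L _), map_mul _ _ ω, map_add (φ ^ ℓ) (_ * _),
        map_mul, map_mul, hσ, hσ, map_add (φ ^ ℓ) (β * _), hσ, hω] at e'
      field_simp
      field_simp at e e'
      linear_combination e + e')
  obtain ⟨x, hx⟩ := exists_ne (0 : K)
  refine hx (M.injective ?_)
  rw [map_zero]
  exact DFunLike.congr_fun hM x

end NotStronglyIsotopic

/-! ### Squares and powers in the finite fields -/

section Arithmetic

theorem exists_odd_sq_sub_one_mul (q : ℕ) {ℓ : ℕ} (hq : Odd q) (hℓ : Odd ℓ) :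
    ∃ s, Odd s ∧ q ^ (2 * ℓ) = (q ^ 2 - 1) * s + 1 := by
  refine ⟨∑ i ∈ Finset.range ℓ, (q ^ 2) ^ i, ?_, ?_⟩
  · rw [Finset.odd_sum_iff_odd_card_odd, Finset.filter_true_of_mem fun i _ => (hq.pow).pow]
    simpa using hℓ
  · have h1 : 1 ≤ q ^ 2 := Nat.one_le_pow _ _ hq.pos
    have := geom_sum_mul_of_one_le h1 ℓ
    rw [mul_comm (q ^ 2 - 1), this, pow_mul]
    have : 1 ≤ (q ^ 2) ^ ℓ := Nat.one_le_pow _ _ h1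
    omega

theorem Odd.not_isSquare_pow {K : Type*} [Field K] {s : ℕ} (hs : Odd s) {g : K}
    (hg : ¬ IsSquare g) : ¬ IsSquare (g ^ s) := by
  obtain ⟨m, rfl⟩ := hs
  rintro ⟨r, hr⟩
  have hg0 : g ≠ 0 := by
    rintro rfl
    exact hg (IsSquare.zero)
  refine hg ⟨r / g ^ m, ?_⟩
  rw [div_mul_div_comm, ← hr, pow_succ, two_mul, pow_add]
  field_simp

theorem pow_eq_neg_of_mul_self_eq_neg_one {K : Type*} [Field K] {n : ℕ} (hn : n % 4 = 3) {s : K}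
    (hs : s * s = -1) : s ^ n = -s := by
  rw [← Nat.div_add_mod n 4, hn, pow_add, pow_mul, show s ^ 4 = (s * s) * (s * s) by ring,
    show s ^ 3 = s * s * s by ring, hs]
  simp

/-- A nonsquare of `K` in `𝔽_{q²}` has norm `-1` to `𝔽_q` after raising it to the power
`(q - 1) / 2`. -/
theorem pow_half_mul_pow_eq_neg_one {K : Type*} [Field K] [Finite K] {q ℓ : ℕ} (hq : q % 4 = 3)
    (hℓ : Odd ℓ) (hK : Nat.card K = q ^ (2 * ℓ)) (h2 : ringChar K ≠ 2) {β : K} (hβ0 : β ≠ 0)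
    (hβ : β ^ q ^ 2 = β) (hsq : ¬ IsSquare β) :
    β ^ ((q - 1) / 2) * (β ^ ((q - 1) / 2)) ^ q = -1 := by
  have := Fintype.ofFinite K
  obtain ⟨s, -, hs⟩ := exists_odd_sq_sub_one_mul q (ℓ := ℓ) (Nat.odd_iff.2 (by omega)) hℓ
  obtain ⟨t, rfl⟩ : ∃ t, q = 4 * t + 3 := ⟨q / 4, by omega⟩
  rw [show (4 * t + 3 - 1) / 2 = 2 * t + 1 by omega, ← pow_mul, ← pow_add]
  have hq2 : (4 * t + 3) ^ 2 - 1 = 2 * (2 * t + 1 + (2 * t + 1) * (4 * t + 3)) := by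
    rw [Nat.sub_eq_iff_eq_add (Nat.one_le_pow _ _ (by omega))]
    ring
  set e := 2 * t + 1 + (2 * t + 1) * (4 * t + 3) with he
  have h1 : β ^ e * β ^ e = 1 := by
    refine mul_right_cancel₀ hβ0 ?_
    rw [one_mul, ← pow_add, ← pow_succ, ← two_mul, ← hq2,
      Nat.sub_add_cancel (Nat.one_le_pow _ _ (by omega)), hβ]
  refine (mul_self_eq_one_iff.1 h1).resolve_left fun h => hsq ?_
  rw [FiniteField.isSquare_iff h2 hβ0, ← Nat.card_eq_fintype_card, hK, hs, hq2,
    show (2 * e * s + 1) / 2 = e * s by rw [mul_assoc]; omega, pow_mul, h, one_pow]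

end Arithmetic

/-! ### Assembly of the theorem -/

theorem theorem5p2 (p h q ℓ : ℕ) (hp : p.Prime) (hq : q = p ^ h) (hq4 : (q : ℤ) ≡ -1 [ZMOD 4])
    (hℓ : Odd ℓ) (hℓ1 : 1 < ℓ)
    {K : Type*} [Field K] [Finite K] (hK : Nat.card K = q ^ (2 * ℓ)) :
    (∃ β ω : K, IsAdmissible q ℓ β ω) ∧
    ∀ β ω : K, IsAdmissible q ℓ β ω →
      IsCommPresemifield (lmptbMul q ℓ : K → K → K) ∧
      IsCommPresemifield (bhbMul q ℓ 2 β ω) ∧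
      ¬ IsStronglyIsotopic (lmptbMul q ℓ : K → K → K) (bhbMul q ℓ 2 β ω) ∧
      IsIsotopic (lmptbMul q ℓ : K → K → K) (bhbMul q ℓ 2 β ω) ∧
      ∃ f g : Polynomial K,
        IsDembowskiOstrom p (2 * ℓ * h) f ∧ IsPlanar f ∧ polarMul f = lmptbMul q ℓ ∧
        IsDembowskiOstrom p (2 * ℓ * h) g ∧ IsPlanar g ∧ polarMul g = bhbMul q ℓ 2 β ω ∧
        ¬ CCZEquivalent (fun x => f.eval x) (fun x => g.eval x) := by
  have : Fact p.Prime := ⟨hp⟩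
  have hq3 : q % 4 = 3 := by
    rw [Int.ModEq] at hq4
    omega
  have hqodd : Odd q := Nat.odd_iff.2 (by omega)
  have hqℓ : q ^ ℓ % 4 = 3 := by
    obtain ⟨k, rfl⟩ := hℓ
    rw [pow_succ, pow_mul, Nat.mul_mod, Nat.pow_mod, Nat.pow_mod q 2, hq3]
    simp
  have hh : h ≠ 0 := by
    rintro rfl
    simp [hq] at hq3
  have hKp : Nat.card K = p ^ (2 * ℓ * h) := by
    rw [hK, hq, ← pow_mul, mul_comm]
  have : CharP K p := by
    have := Fintype.ofFinite K
    exact charP_of_card_eq_prime_pow (R := K) (by rw [← Nat.card_eq_fintype_card]; exact hKp)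
  let _ : Algebra (ZMod p) K := ZMod.algebra K p
  have hfin : Module.finrank (ZMod p) K = 2 * ℓ * h := by
    have := Module.natCard_eq_pow_finrank (K := ZMod p) (V := K)
    rw [hKp, Nat.card_zmod] at this
    exact (Nat.pow_right_injective hp.two_le this).symm
  have hp2 : ringChar K ≠ 2 := by
    rw [ringChar.eq K p]
    rintro rfl
    rw [hq] at hqodd
    exact absurd (even_two.pow_of_ne_zero hh) (Nat.not_even_iff_odd.2 hqodd)
  have h2 : (2 : K) ≠ 0 := Ring.two_ne_zero hp2
  have hcard (x : K) : x ^ q ^ (2 * ℓ) = x := by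
    have := Fintype.ofFinite K
    rw [← hK, Nat.card_eq_fintype_card, FiniteField.pow_card]
  let Φ := FiniteField.frobeniusAlgEquivOfAlgebraic (ZMod p) K
  have hord : orderOf Φ = 2 * ℓ * h := by
    rw [FiniteField.orderOf_frobeniusAlgEquivOfAlgebraic, hfin]
  let φ := Φ ^ h
  have hφ (x : K) : φ x = x ^ q := by
    rw [AlgEquiv.coe_pow, FiniteField.coe_frobeniusAlgEquivOfAlgebraic_iterate, ZMod.card, ← hq]
  have hφi := frobenius_pow_apply hφ
  have hφinj : ∀ i < 2 * ℓ, ∀ j < 2 * ℓ, φ ^ i = φ ^ j → i = j := by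
    intro i hi j hj hij
    rw [← pow_mul, ← pow_mul] at hij
    have hlt : ∀ n < 2 * ℓ, h * n < orderOf Φ := fun n hn => by
      rw [hord, mul_comm]
      exact Nat.mul_lt_mul_of_pos_right hn (Nat.pos_of_ne_zero hh)
    exact Nat.eq_of_mul_eq_mul_left (Nat.pos_of_ne_zero hh)
      (pow_injOn_Iio_orderOf (hlt i hi) (hlt j hj) hij)
  have hσ (x : K) : (φ ^ ℓ) ((φ ^ ℓ) x) = x := by
    rw [aut_pow_apply_pow_apply, ← two_mul, hφi, hcard]
  obtain ⟨s, hsodd, hs⟩ := exists_odd_sq_sub_one_mul q hqodd hℓ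
  have hq2 : 1 ≤ q ^ 2 := Nat.one_le_pow _ _ hqodd.pos
  have hpow (x : K) (hx : x ≠ 0) : x ^ ((q ^ 2 - 1) * s) = 1 := by
    refine mul_right_cancel₀ hx ?_
    rw [← pow_succ, ← hs, hcard, one_mul]
  -- `τx / x = x ^ (q² - 1)` has `s`-th power `1` with `s` odd, so negating it would give `1 = -1`.
  have hr : ∀ x, x ≠ 0 → (φ ^ ℓ) ((φ ^ 2) x / x) ≠ -((φ ^ 2) x / x) := by
    intro x hx hneg
    have h1 : ((φ ^ 2) x / x) ^ s = 1 := by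
      rw [hφi, ← hpow x hx, pow_mul]
      congr 1
      rw [div_eq_iff hx, ← pow_succ, Nat.sub_add_cancel hq2]
    have h3 := congrArg (· ^ s) hneg
    simp only [← map_pow, hsodd.neg_pow, h1, map_one] at h3
    exact h2 (by linear_combination h3)
  have hneg (t : K) (ht : t * t = -1) : (φ ^ ℓ) t ≠ t := fun h => by
    rw [hφi, pow_eq_neg_of_mul_self_eq_neg_one hqℓ ht] at h
    have : 2 * t = 0 := by linear_combination -h
    have ht0 := (mul_eq_zero.1 this).resolve_left h2
    simp [ht0] at ht
  refine ⟨?_, fun β ω hβω => ?_⟩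
  · obtain ⟨g, hg⟩ := FiniteField.exists_nonsquare hp2
    have hg0 : g ≠ 0 := by
      rintro rfl
      exact hg IsSquare.zero
    obtain ⟨i, hi⟩ : IsSquare (-1 : K) := by
      have := Fintype.ofFinite K
      rw [FiniteField.isSquare_neg_one_iff, ← Nat.card_eq_fintype_card, hK, mul_comm, pow_mul,
        Nat.pow_mod, hqℓ]
      simp
    -- The exponent `s = (q^(2ℓ) - 1) / (q² - 1)` puts `g ^ s` in `𝔽_{q²}`, and `s` odd keeps it a
    -- nonsquare; `ω` is a square root of `-1`.
    refine ⟨g ^ s, i, ?_, hsodd.not_isSquare_pow hg, ?_, ?_⟩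
    · rw [← pow_mul, show s * q ^ 2 = (q ^ 2 - 1) * s + s by
        rw [mul_comm, ← Nat.succ_mul, Nat.succ_eq_add_one, Nat.sub_add_cancel hq2], pow_add,
        hpow g hg0, one_mul]
    · rw [← hφi]
      exact hneg i hi.symm
    · exact pow_eq_neg_of_mul_self_eq_neg_one hqℓ hi.symm
  · obtain ⟨hβ, hβsq, hωne, hω⟩ := hβω
    have hβ0 : β ≠ 0 := by
      rintro rfl
      exact hβsq IsSquare.zero
    have hω0 : ω ≠ 0 := by
      rintro rfl
      rw [hω, neg_zero] at hωne
      exact hωne rfl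
    rw [← hφi] at hω hβ
    have hσβ : (φ ^ ℓ) β = β ^ q := by
      obtain ⟨k, rfl⟩ := hℓ
      have hfix (n : ℕ) : (φ ^ (2 * n)) β = β := by
        induction n with
        | zero => simp
        | succ n ih => rw [mul_add, mul_one, pow_add, AlgEquiv.mul_apply, hβ, ih]
      rw [add_comm, pow_add, AlgEquiv.mul_apply, hfix, pow_one, hφ]
    have hP := lmptbMul_isCommPresemifield hφ h2 hσ hℓ hr
    have hiso : IsIsotopic (lmptbMul q ℓ : K → K → K) (bhbMul q ℓ 2 β ω) := by
      refine lmptbMul_isIsotopic_bhbMul (a := β ^ ((q - 1) / 2)) hφ h2 hσ hℓ hω hω0 hβ0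
        (by rw [map_pow, hβ]) ?_ ?_
      · rw [← pow_mul, ← pow_succ', hσβ]
        congr 1
        omega
      · rw [map_pow, hσβ, ← pow_mul, mul_comm q, pow_mul]
        exact pow_half_mul_pow_eq_neg_one hq3 hℓ hK hp2 hβ0 (by rwa [← hφi]) hβsq
    have hB : IsCommPresemifield (bhbMul q ℓ 2 β ω) :=
      ⟨hiso.isPresemifield hP.toIsPresemifield, bhbMul_comm β ω⟩
    have hnot : ¬ IsStronglyIsotopic (lmptbMul q ℓ : K → K → K) (bhbMul q ℓ 2 β ω) := by
      refine not_isStronglyIsotopic_lmptbMul_bhbMul hφ h2 hσ hℓ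
        (fun t ht htt => hneg t htt ht) (fun h => ?_) (fun h => ?_) (fun h => ?_) hω
      · have := hφinj ℓ (by omega) 0 (by omega) (by rw [h, pow_zero])
        omega
      · have := hφinj 2 (by omega) 0 (by omega) (by rw [h, pow_zero])
        omega
      · have := hφinj 2 (by omega) ℓ (by omega) h
        obtain ⟨k, rfl⟩ := hℓ
        omega
    obtain ⟨f, hf1, hf2, hf3, hf⟩ := hP.exists_dembowskiOstrom hfin h2
    obtain ⟨g, hg1, hg2, hg3, hg⟩ := hB.exists_dembowskiOstrom hfin h2
    refine ⟨hP, hB, hnot, hiso, f, g, hf1, hf2, hf3, hg1, hg2, hg3, fun hccz => hnot ?_⟩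
    simp only [hf, hg] at hccz
    exact hccz.isStronglyIsotopic h2 hP hB
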